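/- Let $m\ge 2$, let $\mathbb{F}_{2^m}$ be the field with $2^m$ elements, and let $\mathrm{Tr}$ be the trace from $\mathbb{F}_{2^m}$ to $\mathbb{F}_2$. Put $f_2(x)=\mathrm{Tr}(x)$, $g_2(y)=\mathrm{Tr}(y^2)$ and $$\mathcal{D}=\{(x,y)\in\mathbb{F}_{2^m}^2 : f_2(x)+g_2(y)=0\}.$$ Let $\mathcal{C}_{f_2,g_2}$ be the linear code over $\mathbb{F}_{2^m}$ generated by the rows of the $3\times(1+\#\mathcal{D})$ matrix whose first column is $(0,1,0)^T$ and whose other columns are $(1,x,y)^T$, $(x,y)\in\mathcal{D}$. Let $\mathcal{C}_{f_2,g_2}^{(2)}$ be its binary subfield code: choose a generator matrix $G$ of $\mathcal{C}_{f_2,g_2}$ (a matrix whose rows form a basis of the code) and a basis of $\mathbb{F}_{2^m}$ over $\mathbb{F}_2$, replace every entry of $G$ by the column of its $m$ coordinates in this basis, and take the binary code generated by the rows of the resulting matrix. Let $\bar{\mathcal{C}}_{f_2,g_2}^{(2)}$ be the code obtained from $\mathcal{C}_{f_2,g_2}^{(2)}$ by deleting the first coordinate, and let $\bar{\mathcal{C}}_{f_2,g_2}^{(2)\perp}$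 be its dual with respect to the standard dot product. A $t$-$(n,\kappa,\lambda)$ design consists of a set of $n$ points and a set of $\kappa$-subsets (blocks) such that every $t$-subset of points lies in exactly $\lambda$ blocks. The codewords of weight $\kappa$ of a code of length $n$ hold a $t$-$(n,\kappa,\lambda)$ design if there are such codewords and their supports, taken without repetition, are the blocks of a $t$-$(n,\kappa,\lambda)$ design on the coordinate positions, with $\lambda\ge 1$. Then, for every choice of $G$ and of the basis: 1. $\bar{\mathcal{C}}_{f_2,g_2}^{(2)}$ is, up to a bijection between the coordinate positions, the first-order binary Reed-Muller code $\mathcal{RM}(1,2m-1)$ (the value vectors on $\mathbb{F}_2^{2m-1}$ of the polynomials of degree at most $1$ in $2m-1$ variables over $\mathbb{F}_2$). 2. The codewords of Hamming weight $2^{2m-2}$ in $\bar{\mathcal{C}}_{f_2,g_2}^{(2)}$ hold a $3$-$(2^{2m-1},\,2^{2m-2},\,2^{2m-3}-1)$ design. 3. For every even integer $\kappa$ with $4\le\kappa\le 2^{2m-1}-4$ there is $\lambda\ge 1$ such that the codewords of Hamming weight $\kappa$ in $\bar{\mathcal{C}}_{f_2,g_2}^{(2)\perp}$ hold a $3$-$(2^{2m-1},\kappa,\lambda)$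 design. -/

import Mathlib

namespace CodeDesign

/-- `G` is a generator matrix of the linear code `C`: its rows form a basis of `C`. -/
def IsGeneratorMatrix {K n k : Type*} [Field K] (G : Matrix k n K)
    (C : Submodule K (n → K)) : Prop :=
  LinearIndependent K G.row ∧ Submodule.span K (Set.range G.row) = C

/-- The dual code with respect to the standard dot product. -/
def dualCode {K n : Type*} [Field K] [Fintype n] (C : Submodule K (n → K)) :
    Submodule K (n → K) where
  carrier := {x | ∀ c ∈ C, x ⬝ᵥ c = 0}
  zero_mem' := fun c _ => zero_dotProduct c
  add_mem' := fun {x y} hx hy c hc => by rw [add_dotProduct, hx c hc, hy c hc, add_zero]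
  smul_mem' := fun a x hx c hc => by rw [smul_dotProduct, hx c hc, smul_zero]

/-- The code obtained by deleting the coordinate `i` in every codeword. -/
def puncture {K n : Type*} [Field K] (C : Submodule K (n → K)) (i : n) :
    Submodule K ({j : n // j ≠ i} → K) :=
  C.map (LinearMap.funLeft K K (Subtype.val : {j : n // j ≠ i} → n))

/-- Every entry of `G` is replaced by the column vector of its coordinates in the basis `b`. -/
noncomputable def expandMatrix {K F k n ι : Type*} [Field K] [Field F] [Algebra K F]
    (b : Module.Basis ι K F) (G : Matrix k n F) : Matrix (k × ι) n K :=
  Matrix.of fun r j => b.repr (G r.1 j) r.2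

/-- The subfield code, over `K`, of the code over `F` with generator matrix `G`, computed with the
basis `b` of `F` over `K`: the code generated by the rows of the expanded matrix. -/
noncomputable def subfieldCode {K F k n ι : Type*} [Field K] [Field F] [Algebra K F]
    (b : Module.Basis ι K F) (G : Matrix k n F) : Submodule K (n → K) :=
  Submodule.span K (Set.range (expandMatrix b G).row)

/-- The solutions `(x, y)` of `f x + g y = 0`. -/
abbrev Sol {K F : Type*} [Field K] (f g : F → K) : Type _ :=
  {p : F × F // f p.1 + g p.2 = 0}

/-- The matrix with first column `(0, 1, 0)` (indexed by `none`), followed by the columns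
`(1, x, y)` for the solutions `(x, y)` of `f x + g y = 0`. -/
def genMatrix {K F : Type*} [Field K] [Field F] (f g : F → K) :
    Matrix (Fin 3) (Option (Sol f g)) F :=
  Matrix.of fun i j => match j with
    | none => ![0, 1, 0] i
    | some p => ![1, p.1.1, p.1.2] i

/-- The linear code over `F` generated by the rows of `genMatrix f g`. -/
def code {K F : Type*} [Field K] [Field F] (f g : F → K) :
    Submodule F (Option (Sol f g) → F) :=
  Submodule.span F (Set.range (genMatrix f g).row)

/-- The support of a word. -/
def wordSupport {K n : Type*} [Field K] [DecidableEq K] [Fintype n] (c : n → K) : Finset n :=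
  Finset.univ.filter fun i => c i ≠ 0

/-- The set of the supports of the codewords of Hamming weight `κ`. -/
def blocks {K n : Type*} [Field K] [DecidableEq K] [Fintype n] (C : Submodule K (n → K))
    (κ : ℕ) : Set (Finset n) :=
  {B | ∃ c ∈ C, hammingNorm c = κ ∧ wordSupport c = B}

/-- The point set `P` with the block set `𝓑` is a (simple) `t-(v, κ, lam)` design. -/
structure IsDesign {P : Type*} [Fintype P] (𝓑 : Set (Finset P)) (t v κ lam : ℕ) : Prop where
  card_points : Fintype.card P = v
  t_pos : 1 ≤ t
  t_le : t ≤ κ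
  block_size_le : κ ≤ v
  card_block : ∀ B ∈ 𝓑, B.card = κ
  balanced : ∀ T : Finset P, T.card = t → {B ∈ 𝓑 | T ⊆ B}.ncard = lam

/-- The codewords of weight `κ` in `C` hold a `t-(v, κ, lam)` design: there are such codewords,
and their supports are the blocks of a `t-(v, κ, lam)` design with `lam` positive. -/
def HoldsDesign {K n : Type*} [Field K] [DecidableEq K] [Fintype n] (C : Submodule K (n → K))
    (t v κ lam : ℕ) : Prop :=
  (∃ c ∈ C, hammingNorm c = κ) ∧ 1 ≤ lam ∧ IsDesign (blocks C κ) t v κ lam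

/-- The function `x ↦ Tr x` from `F` to the subfield `K`. -/
noncomputable def traceFun (K F : Type*) [Field K] [Field F] [Algebra K F] : F → K :=
  fun x => Algebra.trace K F x

/-- The function `y ↦ Tr (y ^ 2)` from `F` to the subfield `K`. -/
noncomputable def traceSqFun (K F : Type*) [Field K] [Field F] [Algebra K F] : F → K :=
  fun y => Algebra.trace K F (y ^ 2)

/-- The binary Reed-Muller code of order `r` and length `2 ^ s`: the value vectors of the
polynomials over `𝔽₂` in `s` variables of total degree at most `r`. -/
noncomputable def reedMuller (r s : ℕ) : Submodule (ZMod 2) ((Fin s → ZMod 2) → ZMod 2) :=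
  (MvPolynomial.restrictTotalDegree (Fin s) (ZMod 2) r).map
    (MvPolynomial.evalₗ (ZMod 2) (Fin s))

/-- `C` and `C'` agree up to a bijection between their coordinate sets. -/
def PermEquiv {K n n' : Type*} [Field K] (C : Submodule K (n → K))
    (C' : Submodule K (n' → K)) : Prop :=
  ∃ e : n ≃ n', C'.map (LinearMap.funLeft K K e) = C

end CodeDesign

/-! Squaring is additive in characteristic 2, so the point set is the kernel `S` of a nonzero binary
functional on `F × F`, of dimension `2m - 1`. The binary subfield code is spanned by the
compositions of the rows `1, x, y` with all functionals `F → 𝔽₂`, whatever generator matrix and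
basis are used. Without the first coordinate these are constants and functionals on `S`, so the code
consists of all affine functions on `S` (`puncture_subfieldCode`), which is the first-order
Reed-Muller code.

The words of half weight are the indicators of affine hyperplanes, and those through three points
are counted by an annihilator (`ncard_hyperplanes_through`). The supports of dual words are the sets
of even size with sum zero. Affine bijections preserve this family and are transitive on ordered
triples of distinct points, so the number of blocks through a triple is constant
(`dualCode_affineCode_holdsDesign`); an explicit block makes it positive. -/

namespace CodeDesign

open Module

/-- The words `v ↦ φ v + c` with `φ` a linear functional and `c` a constant. -/
def affineCode (K V : Type*) [Field K] [AddCommGroup V] [Module K V] : Submodule K (V → K) where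
  carrier := {f | ∃ (φ : Dual K V) (c : K), ∀ v, f v = φ v + c}
  zero_mem' := ⟨0, 0, fun v => by simp⟩
  add_mem' := by
    rintro f g ⟨φ, c, hf⟩ ⟨ψ, d, hg⟩
    refine ⟨φ + ψ, c + d, fun v => ?_⟩
    simp only [Pi.add_apply, hf, hg, LinearMap.add_apply]
    ring
  smul_mem' := by
    rintro a f ⟨φ, c, hf⟩
    refine ⟨a • φ, a * c, fun v => ?_⟩
    simp only [Pi.smul_apply, hf, LinearMap.smul_apply, smul_eq_mul]
    ring

theorem mem_dualCode {K n : Type*} [Field K] [Fintype n] {C : Submodule K (n → K)} {x : n → K} :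
    x ∈ dualCode C ↔ ∀ c ∈ C, x ⬝ᵥ c = 0 := Iff.rfl

section Words

variable {K n : Type*} [Field K] [DecidableEq K] [Fintype n]

theorem mem_wordSupport {c : n → K} {i : n} : i ∈ wordSupport c ↔ c i ≠ 0 := by
  simp [wordSupport]

theorem card_wordSupport (c : n → K) : (wordSupport c).card = hammingNorm c := rfl

theorem mem_blocks {C : Submodule K (n → K)} {κ : ℕ} {B : Finset n} :
    B ∈ blocks C κ ↔ ∃ c ∈ C, wordSupport c = B ∧ B.card = κ := by
  constructor
  · rintro ⟨c, hc, h, rfl⟩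
    exact ⟨c, hc, rfl, h⟩
  · rintro ⟨c, hc, rfl, h⟩
    exact ⟨c, hc, h, rfl⟩

end Words

theorem ne_zero_iff_eq_one (a : ZMod 2) : a ≠ 0 ↔ a = 1 := by
  revert a; decide

/-! ### Affine functions and the hyperplane design -/

section Affine

variable {V : Type*} [AddCommGroup V] [Module (ZMod 2) V]

theorem add_self_eq_zero (v : V) : v + v = 0 := by
  have : (2 : ZMod 2) • v = 0 := by rw [show (2 : ZMod 2) = 0 from rfl, zero_smul]
  rwa [two_smul] at this

theorem linearIndependent_sub_sub {a b c : V} (hab : a ≠ b) (hac : a ≠ c) (hbc : b ≠ c) :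
    LinearIndependent (ZMod 2) ![b - a, c - a] := by
  rw [LinearIndependent.pair_iff]
  have key : ∀ x : ZMod 2, x = 0 ∨ x = 1 := by decide
  intro s t h
  rcases key s with rfl | rfl <;> rcases key t with rfl | rfl
  · simp
  · simp [sub_eq_zero, hac.symm] at h
  · simp [sub_eq_zero, hab.symm] at h
  · exfalso
    apply hbc
    have h2 := add_self_eq_zero (c - a)
    rw [one_smul, one_smul] at h
    exact sub_left_injective (add_right_cancel (h.trans h2.symm))

variable [Fintype V]

/-- Translation by a vector `w` with `φ w = 1` exchanges the support and its complement. -/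
theorem card_wordSupport_affine {φ : Dual (ZMod 2) V} (hφ : φ ≠ 0) (c : ZMod 2)
    {f : V → ZMod 2} (hf : ∀ v, f v = φ v + c) :
    2 * (wordSupport f).card = Fintype.card V := by
  classical
  obtain ⟨w, hw⟩ : ∃ w, φ w ≠ 0 := by
    by_contra! h
    exact hφ (LinearMap.ext h)
  rw [ne_zero_iff_eq_one] at hw
  have h1 : (wordSupport f).card = (wordSupport f)ᶜ.card := by
    refine Finset.card_bij (fun v _ => v + w) ?_ (fun _ _ _ _ h => add_right_cancel h) ?_
    · intro v hv
      rw [mem_wordSupport, hf] at hv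
      rw [Finset.mem_compl, mem_wordSupport, hf, map_add, hw]
      generalize φ v = x at hv ⊢
      clear hf; revert x c; decide
    · intro v hv
      refine ⟨v + w, ?_, by rw [add_assoc, add_self_eq_zero, add_zero]⟩
      rw [Finset.mem_compl, mem_wordSupport, hf] at hv
      rw [mem_wordSupport, hf, map_add, hw]
      generalize φ v = x at hv ⊢
      clear hf; revert x c; decide
  have h2 := Finset.card_add_card_compl (wordSupport f)
  omega

theorem card_eq_two_pow {n : ℕ} (hn : finrank (ZMod 2) V = n) : Fintype.card V = 2 ^ n := by
  rw [Module.card_eq_pow_finrank (K := ZMod 2), ZMod.card, hn]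

theorem mem_blocks_affineCode {n : ℕ} (hn : finrank (ZMod 2) V = n) (h1 : 1 ≤ n) {B : Finset V} :
    B ∈ blocks (affineCode (ZMod 2) V) (2 ^ (n - 1)) ↔
      ∃ φ : Dual (ZMod 2) V, φ ≠ 0 ∧ ∃ c, ∀ v, v ∈ B ↔ φ v = c := by
  have hV := card_eq_two_pow hn
  obtain ⟨n, rfl⟩ : ∃ k, n = k + 1 := ⟨n - 1, by omega⟩
  rw [mem_blocks]
  constructor
  · rintro ⟨f, ⟨φ, c, hf⟩, rfl, hB⟩
    refine ⟨φ, ?_, c + 1, fun v => ?_⟩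
    -- A constant word has empty or full support, never half of the space.
    · rintro rfl
      have h0 : wordSupport f = ∅ ∨ wordSupport f = Finset.univ := by
        by_cases hc : c = 0
        · left; ext v; simp [mem_wordSupport, hf, hc]
        · right; ext v; simp [mem_wordSupport, hf, hc]
      have hp : 0 < 2 ^ n := by positivity
      rcases h0 with h0 | h0 <;> rw [h0] at hB
      · simp only [Finset.card_empty, Nat.add_sub_cancel] at hB; omega
      · rw [Finset.card_univ, hV, pow_succ] at hB
        simp only [Nat.add_sub_cancel] at hB; omega
    · rw [mem_wordSupport, hf]
      generalize φ v = x
      clear hf; revert x c; decide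
  · rintro ⟨φ, hφ, c, hB⟩
    have hf : wordSupport (fun v => φ v + (c + 1)) = B := by
      ext v
      rw [mem_wordSupport, hB]
      generalize φ v = x
      clear hB; revert x c; decide
    refine ⟨fun v => φ v + (c + 1), ⟨φ, c + 1, fun _ => rfl⟩, hf, ?_⟩
    have := card_wordSupport_affine hφ (c + 1) (f := fun v => φ v + (c + 1)) (fun _ => rfl)
    rw [hf, hV, pow_succ] at this
    simp only [Nat.add_sub_cancel]; omega

/-- Hyperplanes through `a, b, c` correspond to the nonzero functionals killing `b - a` and `c - a`.
These two vectors are independent, so their annihilator has dimension `n - 2`. -/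
theorem ncard_hyperplanes_through {n : ℕ} (hn : finrank (ZMod 2) V = n)
    (h1 : 1 ≤ n) {T : Finset V} (hT : T.card = 3) :
    {B ∈ blocks (affineCode (ZMod 2) V) (2 ^ (n - 1)) | T ⊆ B}.ncard = 2 ^ (n - 2) - 1 := by
  classical
  obtain ⟨a, b, c, hab, hac, hbc, rfl⟩ := Finset.card_eq_three.mp hT
  have hfin : Module.Finite (ZMod 2) V := Module.Finite.of_finite
  set W := Submodule.span (ZMod 2) (Set.range ![b - a, c - a]) with hW
  have hWr : finrank (ZMod 2) W = 2 := by
    simpa using finrank_span_eq_card (linearIndependent_sub_sub hab hac hbc)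
  have hmem : ∀ φ : Dual (ZMod 2) V, φ ∈ W.dualAnnihilator ↔ φ b = φ a ∧ φ c = φ a := by
    intro φ
    rw [Submodule.mem_dualAnnihilator]
    constructor
    · intro h
      have h1 := h (b - a) (Submodule.subset_span ⟨0, rfl⟩)
      have h2 := h (c - a) (Submodule.subset_span ⟨1, rfl⟩)
      rw [map_sub, sub_eq_zero] at h1 h2
      exact ⟨h1, h2⟩
    · rintro ⟨h1, h2⟩
      have : W ≤ LinearMap.ker φ := by
        rw [hW, Submodule.span_le]
        rintro _ ⟨i, rfl⟩
        fin_cases i <;> simp [h1, h2]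
      exact fun w hw => this hw
  have himage : {B ∈ blocks (affineCode (ZMod 2) V) (2 ^ (n - 1)) | {a, b, c} ⊆ B} =
      (fun φ : Dual (ZMod 2) V => Finset.univ.filter fun v => φ v = φ a) ''
        ((W.dualAnnihilator : Set (Dual (ZMod 2) V)) \ {0}) := by
    ext B
    simp only [Set.mem_ofPred_eq, mem_blocks_affineCode hn h1, Set.mem_image, Set.mem_sdiff,
      SetLike.mem_coe, hmem, Set.mem_singleton_iff, Finset.insert_subset_iff,
      Finset.singleton_subset_iff]
    constructor
    · rintro ⟨⟨φ, hφ, d, hB⟩, ha, hb, hc⟩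
      rw [hB] at ha hb hc
      refine ⟨φ, ⟨⟨hb.trans ha.symm, hc.trans ha.symm⟩, hφ⟩, ?_⟩
      ext v
      simp [hB, ha]
    · rintro ⟨φ, ⟨⟨hb, hc⟩, hφ⟩, rfl⟩
      exact ⟨⟨φ, hφ, φ a, by simp⟩, by simp, by simp [hb], by simp [hc]⟩
  rw [himage, Set.ncard_image_of_injective, Set.ncard_sdiff_singleton_of_mem (zero_mem _)]
  · congr 1
    have h2 := Subspace.finrank_add_finrank_dualAnnihilator_eq W
    rw [← Nat.card_coe_set_eq]
    change Nat.card W.dualAnnihilator = _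
    rw [Module.natCard_eq_pow_finrank (K := ZMod 2), Nat.card_zmod]
    congr 1
    omega
  -- Evaluating at `x + a` shows that `φ` and `ψ` have the same kernel, which determines a
  -- functional over `𝔽₂`.
  · intro φ ψ h
    have h' : ∀ v, φ v = φ a ↔ ψ v = ψ a := fun v => by
      simpa using Finset.ext_iff.mp h v
    ext x
    have hx := h' (x + a)
    simp only [map_add, add_eq_right] at hx
    generalize φ x = s at *
    generalize ψ x = t at *
    revert s t; decide

theorem affineCode_holdsDesign {n : ℕ} (hn : finrank (ZMod 2) V = n) (h3 : 3 ≤ n) :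
    HoldsDesign (affineCode (ZMod 2) V) 3 (2 ^ n) (2 ^ (n - 1)) (2 ^ (n - 2) - 1) := by
  have h4 : 2 ^ 2 ≤ 2 ^ (n - 1) := Nat.pow_le_pow_right (by norm_num) (by omega)
  have h5 : 2 ^ 1 ≤ 2 ^ (n - 2) := Nat.pow_le_pow_right (by norm_num) (by omega)
  refine ⟨?_, by omega, card_eq_two_pow hn, by norm_num, by omega,
    Nat.pow_le_pow_right (by norm_num) (by omega), ?_, fun T hT => ncard_hyperplanes_through hn (by omega) hT⟩
  · have : Nontrivial V := Module.nontrivial_of_finrank_pos (R := ZMod 2) (by omega)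
    obtain ⟨φ, hφ⟩ := exists_ne (0 : Dual (ZMod 2) V)
    refine ⟨φ, ⟨φ, 0, by simp⟩, ?_⟩
    have := card_wordSupport_affine hφ 0 (f := φ) (by simp)
    rw [card_eq_two_pow hn, show n = (n - 1) + 1 by omega, pow_succ, card_wordSupport] at this
    omega
  · rintro B ⟨c, -, h, rfl⟩
    exact h

end Affine

/-! ### Zero-sum sets and the dual design -/

theorem exists_finset_card_sum_ne_zero {V : Type*} [AddCommGroup V]
    [Fintype V] {k : ℕ} (h1 : 1 ≤ k) (h2 : k < Fintype.card V) :
    ∃ A : Finset V, A.card = k ∧ ∑ v ∈ A, v ≠ 0 := by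
  classical
  obtain ⟨A, -, hA⟩ := Finset.exists_subset_card_eq (s := (Finset.univ : Finset V)) (n := k)
    (by rw [Finset.card_univ]; omega)
  by_cases hs : ∑ v ∈ A, v = 0
  -- Replacing `b ∈ A` by `c ∉ A` changes the sum by `c - b ≠ 0`.
  · obtain ⟨b, hb⟩ : A.Nonempty := Finset.card_pos.mp (by omega)
    obtain ⟨c, hc⟩ : ∃ c, c ∉ A := by
      by_contra! h
      rw [Finset.eq_univ_of_forall h, Finset.card_univ] at hA
      omega
    have hc' : c ∉ A.erase b := fun h => hc (Finset.mem_of_mem_erase h)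
    refine ⟨insert c (A.erase b), ?_, ?_⟩
    · rw [Finset.card_insert_of_notMem hc', Finset.card_erase_of_mem hb]
      omega
    · rw [Finset.sum_insert hc']
      rw [← Finset.add_sum_erase A _ hb] at hs
      intro h
      exact hc (add_right_cancel (h.trans hs.symm) ▸ hb)
  · exact ⟨A, hA, hs⟩

section Affine

variable {V : Type*} [AddCommGroup V] [Module (ZMod 2) V]

theorem even_nsmul_eq_zero {k : ℕ} (hk : Even k) (v : V) : k • v = 0 := by
  obtain ⟨r, rfl⟩ := hk
  rw [add_nsmul, add_self_eq_zero]

/-- The differences from the first point are independent in both triples; a linear automorphism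
matches them, and a translation then matches the first points. -/
theorem exists_affine_map_triple {a b c a' b' c' : V} (hab : a ≠ b) (hac : a ≠ c) (hbc : b ≠ c)
    (hab' : a' ≠ b') (hac' : a' ≠ c') (hbc' : b' ≠ c') :
    ∃ (g : V ≃ₗ[ZMod 2] V) (t : V), g a + t = a' ∧ g b + t = b' ∧ g c + t = c' := by
  have h := linearIndependent_sub_sub hab hac hbc
  have h' := linearIndependent_sub_sub hab' hac' hbc'
  have : FiniteDimensional (ZMod 2) (Submodule.span (ZMod 2) (Set.range ![b - a, c - a])) :=
    FiniteDimensional.span_of_finite _ (Set.finite_range _)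
  obtain ⟨g, hg⟩ := Submodule.exists_linearEquiv_restrict_eq
    (h.linearCombinationEquiv.symm ≪≫ₗ h'.linearCombinationEquiv)
  have key : ∀ i, g (![b - a, c - a] i) = ![b' - a', c' - a'] i := by
    intro i
    have e : ((h.linearCombinationEquiv (Finsupp.single i 1) : _) : V) = ![b - a, c - a] i := by
      simp
    rw [← e, ← hg]
    simp
  have k0 : g b - g a = b' - a' := by simpa using key 0
  have k1 : g c - g a = c' - a' := by simpa using key 1
  refine ⟨g, a' - g a, by abel, ?_, ?_⟩
  · rw [← sub_add_cancel (g b) (g a), k0]; abel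
  · rw [← sub_add_cancel (g c) (g a), k1]; abel

variable [Fintype V]

/-- Constants test the first sum; functionals test the second, since they separate points. -/
theorem mem_dualCode_affineCode {x : V → ZMod 2} :
    x ∈ dualCode (affineCode (ZMod 2) V) ↔ ∑ v, x v = 0 ∧ ∑ v, x v • v = 0 := by
  rw [mem_dualCode]
  constructor
  · intro h
    constructor
    · have := h (fun _ => 1) ⟨0, 1, by simp⟩
      simpa [dotProduct] using this
    · rw [← Module.forall_dual_apply_eq_zero_iff (ZMod 2)]
      intro φ
      have := h φ ⟨φ, 0, by simp⟩
      simpa [dotProduct] using this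
  · rintro ⟨h1, h2⟩ f ⟨φ, c, hf⟩
    have h3 := congrArg φ h2
    simp only [map_sum, map_smul, smul_eq_mul, map_zero] at h3
    simp only [dotProduct, hf, mul_add, Finset.sum_add_distrib, h3, ← Finset.sum_mul, h1]
    simp

theorem mem_blocks_dualCode_affineCode {κ : ℕ} {B : Finset V} :
    B ∈ blocks (dualCode (affineCode (ZMod 2) V)) κ ↔
      B.card = κ ∧ Even κ ∧ ∑ v ∈ B, v = 0 := by
  classical
  have hind : ∀ x : V → ZMod 2, x = fun v => if v ∈ wordSupport x then 1 else 0 := by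
    intro x
    ext v
    split_ifs with h
    · rwa [mem_wordSupport, ne_zero_iff_eq_one] at h
    · simpa [mem_wordSupport] using h
  have hsum : ∀ B : Finset V, ((fun v => if v ∈ B then 1 else 0 : V → ZMod 2) ∈
      dualCode (affineCode (ZMod 2) V) ↔ Even B.card ∧ ∑ v ∈ B, v = 0) := by
    intro B
    rw [mem_dualCode_affineCode]
    simp [ite_smul, Finset.sum_ite_mem, ZMod.natCast_eq_zero_iff_even]
  rw [mem_blocks]
  constructor
  · rintro ⟨x, hx, rfl, hB⟩
    rw [hind x, hsum, hB] at hx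
    exact ⟨hB, hx⟩
  · rintro ⟨hB, hκ, hs⟩
    refine ⟨_, (hsum B).mpr ⟨by rwa [hB], hs⟩, ?_, hB⟩
    ext v
    simp [mem_wordSupport]

/-- To `κ - 2` points with sum `u ≠ 0`, adjoin `x` and `x + u`. They are distinct, and both are new
if `x` avoids `A` and `A + u`, which have at most `2(κ - 2)` points together. -/
theorem exists_finset_card_sum_eq_zero_of_le {κ : ℕ} (h4 : 4 ≤ κ)
    (hle : 2 * κ ≤ Fintype.card V) : ∃ B : Finset V, B.card = κ ∧ ∑ v ∈ B, v = 0 := by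
  classical
  obtain ⟨A, hA, hs⟩ := exists_finset_card_sum_ne_zero (V := V) (k := κ - 2) (by omega) (by omega)
  set u := ∑ v ∈ A, v with hu
  obtain ⟨x, hx⟩ : ∃ x, x ∉ A ∪ A.image (· + u) := by
    by_contra! h
    have h1 := Finset.card_union_le A (A.image (· + u))
    have h2 : (A.image (· + u)).card ≤ A.card := Finset.card_image_le
    rw [Finset.eq_univ_of_forall h, Finset.card_univ] at h1
    omega
  rw [Finset.mem_union, not_or] at hx
  have hxu : x + u ∉ A := fun h => hx.2 (Finset.mem_image.mpr
    ⟨x + u, h, by rw [add_assoc, add_self_eq_zero, add_zero]⟩)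
  have hx' : x ∉ insert (x + u) A := by
    simp [hx.1, hs]
  refine ⟨insert x (insert (x + u) A), ?_, ?_⟩
  · rw [Finset.card_insert_of_notMem hx', Finset.card_insert_of_notMem hxu]
    omega
  · rw [Finset.sum_insert hx', Finset.sum_insert hxu, ← hu, add_assoc, add_self_eq_zero, add_zero,
      add_self_eq_zero]

/-- A nonzero functional takes the value 1 at `2 ^ (n - 1)` points, an even number since `n ≥ 2`. -/
theorem sum_univ_eq_zero {n : ℕ} (hn : finrank (ZMod 2) V = n) (h2 : 2 ≤ n) :
    ∑ v : V, v = 0 := by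
  classical
  rw [← Module.forall_dual_apply_eq_zero_iff (ZMod 2)]
  intro φ
  by_cases hφ : φ = 0
  · simp [hφ]
  have hc := card_wordSupport_affine hφ 0 (f := φ) (by simp)
  rw [card_eq_two_pow hn, show n = (n - 2) + 1 + 1 by omega, pow_succ, pow_succ] at hc
  have hsum : ∑ v : V, φ v = ((wordSupport φ).card : ZMod 2) := by
    rw [← Finset.sum_subset (Finset.subset_univ (wordSupport φ))]
    · rw [Finset.sum_congr rfl (g := fun _ => (1 : ZMod 2))]
      · simp
      · intro v hv
        rwa [mem_wordSupport, ne_zero_iff_eq_one] at hv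
    · intro v _ hv
      simpa [mem_wordSupport] using hv
  rw [map_sum, hsum, ZMod.natCast_eq_zero_iff_even]
  exact ⟨2 ^ (n - 2), by omega⟩

theorem exists_finset_card_sum_eq_zero {n : ℕ} (hn : finrank (ZMod 2) V = n) (h2 : 2 ≤ n)
    {κ : ℕ} (h4 : 4 ≤ κ) (hle : κ + 4 ≤ 2 ^ n) :
    ∃ B : Finset V, B.card = κ ∧ ∑ v ∈ B, v = 0 := by
  classical
  have hV := card_eq_two_pow hn
  by_cases h : 2 * κ ≤ 2 ^ n
  · exact exists_finset_card_sum_eq_zero_of_le h4 (by omega)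
  -- Large sizes come from complements, since the whole space sums to zero.
  · obtain ⟨B, hB, hs⟩ := exists_finset_card_sum_eq_zero_of_le (V := V) (κ := 2 ^ n - κ)
      (by omega) (by omega)
    refine ⟨Bᶜ, by rw [Finset.card_compl]; omega, ?_⟩
    rw [← sum_univ_eq_zero hn h2, ← Finset.sum_add_sum_compl B, hs, zero_add]

theorem dualCode_affineCode_holdsDesign {n : ℕ} (hn : finrank (ZMod 2) V = n) (h2 : 2 ≤ n)
    {κ : ℕ} (hκ : Even κ) (h4 : 4 ≤ κ) (hle : κ + 4 ≤ 2 ^ n) :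
    ∃ lam, HoldsDesign (dualCode (affineCode (ZMod 2) V)) 3 (2 ^ n) κ lam := by
  classical
  obtain ⟨B₀, hB₀, hs₀⟩ := exists_finset_card_sum_eq_zero hn h2 h4 hle
  have hmem₀ : B₀ ∈ blocks (dualCode (affineCode (ZMod 2) V)) κ :=
    mem_blocks_dualCode_affineCode.mpr ⟨hB₀, hκ, hs₀⟩
  obtain ⟨T₀, hT₀, hT₀c⟩ := Finset.exists_subset_card_eq (s := B₀) (n := 3) (by omega)
  -- One inequality suffices, because the two triples can be exchanged.
  have hle' : ∀ T T' : Finset V, T.card = 3 → T'.card = 3 →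
      {B ∈ blocks (dualCode (affineCode (ZMod 2) V)) κ | T ⊆ B}.ncard ≤
      {B ∈ blocks (dualCode (affineCode (ZMod 2) V)) κ | T' ⊆ B}.ncard := by
    intro T T' hT hT'
    obtain ⟨a, b, c, hab, hac, hbc, rfl⟩ := Finset.card_eq_three.mp hT
    obtain ⟨a', b', c', hab', hac', hbc', rfl⟩ := Finset.card_eq_three.mp hT'
    obtain ⟨g, t, ha, hb, hc⟩ := exists_affine_map_triple hab hac hbc hab' hac' hbc'
    have hinj : Function.Injective fun v => g v + t :=
      fun _ _ h => g.injective (add_right_cancel h)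
    refine Set.ncard_le_ncard_of_injOn (Finset.image fun v => g v + t) ?_
      (Finset.image_injective hinj).injOn (Set.toFinite _)
    rintro B ⟨hB, hsub⟩
    rw [mem_blocks_dualCode_affineCode] at hB
    obtain ⟨hBc, -, hBs⟩ := hB
    refine ⟨mem_blocks_dualCode_affineCode.mpr ⟨?_, hκ, ?_⟩, ?_⟩
    · rw [Finset.card_image_of_injective _ hinj, hBc]
    -- The translation contributes `κ • t`, which vanishes because `κ` is even.
    · rw [Finset.sum_image hinj.injOn, Finset.sum_add_distrib, Finset.sum_const, hBc,
        even_nsmul_eq_zero hκ, ← map_sum, hBs, map_zero, add_zero]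
    · have := Finset.image_subset_image (f := fun v => g v + t) hsub
      simpa [Finset.image_insert, ha, hb, hc] using this
  refine ⟨{B ∈ blocks (dualCode (affineCode (ZMod 2) V)) κ | T₀ ⊆ B}.ncard, ?_, ?_,
    card_eq_two_pow hn, by norm_num, by omega, by omega, ?_, fun T hT =>
      le_antisymm (hle' _ _ hT hT₀c) (hle' _ _ hT₀c hT)⟩
  · obtain ⟨c, hc, h, -⟩ := hmem₀
    exact ⟨c, hc, h⟩
  · exact (Set.ncard_pos (Set.toFinite _)).mpr ⟨B₀, hmem₀, hT₀⟩
  · rintro B ⟨c, -, h, rfl⟩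
    exact h

end Affine

/-! ### Transport along bijections of coordinates -/

theorem dualCode_map_funLeft {K n n' : Type*} [Field K] [Fintype n] [Fintype n'] (e : n ≃ n') (C : Submodule K (n' → K)) :
    dualCode (C.map (LinearMap.funLeft K K e)) = (dualCode C).map (LinearMap.funLeft K K e) := by
  have hdot : ∀ x c : n' → K,
      LinearMap.funLeft K K e x ⬝ᵥ LinearMap.funLeft K K e c = x ⬝ᵥ c := fun x c =>
    e.sum_comp fun i => x i * c i
  ext x
  constructor
  · intro hx
    have hxe : LinearMap.funLeft K K e (x ∘ e.symm) = x := by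
      ext i; simp [LinearMap.funLeft_apply]
    refine ⟨x ∘ e.symm, fun c hc => ?_, hxe⟩
    rw [← hdot, hxe]
    exact hx _ ⟨c, hc, rfl⟩
  · rintro ⟨y, hy, rfl⟩ _ ⟨c, hc, rfl⟩
    rw [hdot]
    exact hy c hc

section Transport

variable {K n n' : Type*} [Field K] [DecidableEq K] [Fintype n] [Fintype n']

theorem blocks_map_funLeft (e : n ≃ n') (C : Submodule K (n' → K)) (κ : ℕ) :
    blocks (C.map (LinearMap.funLeft K K e)) κ =
      (Finset.map e.symm.toEmbedding) '' blocks C κ := by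
  have hsupp : ∀ c : n' → K,
      wordSupport (LinearMap.funLeft K K e c) = (wordSupport c).map e.symm.toEmbedding := by
    intro c
    ext i
    simp [mem_wordSupport, LinearMap.funLeft_apply]
  ext B
  constructor
  · rintro ⟨_, ⟨c, hc, rfl⟩, h, rfl⟩
    refine ⟨wordSupport c, ⟨c, hc, ?_, rfl⟩, (hsupp c).symm⟩
    rwa [← card_wordSupport, hsupp, Finset.card_map] at h
  · rintro ⟨_, ⟨c, hc, h, rfl⟩, rfl⟩
    refine ⟨_, ⟨c, hc, rfl⟩, ?_, hsupp c⟩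
    rwa [← card_wordSupport, hsupp, Finset.card_map]

theorem HoldsDesign.map_funLeft {C : Submodule K (n' → K)} {t v κ lam : ℕ}
    (h : HoldsDesign C t v κ lam) (e : n ≃ n') :
    HoldsDesign (C.map (LinearMap.funLeft K K e)) t v κ lam := by
  obtain ⟨⟨c, hc, hcκ⟩, hlam, hd⟩ := h
  have hblock : ∀ B ∈ blocks (C.map (LinearMap.funLeft K K e)) κ, B.card = κ := by
    rintro B ⟨c, -, h, rfl⟩
    exact h
  refine ⟨?_, hlam, (Fintype.card_congr e).trans hd.card_points, hd.t_pos, hd.t_le,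
    hd.block_size_le, hblock, fun T hT => ?_⟩
  · have : Finset.map e.symm.toEmbedding (wordSupport c) ∈
        blocks (C.map (LinearMap.funLeft K K e)) κ := by
      rw [blocks_map_funLeft]
      exact ⟨_, ⟨c, hc, hcκ, rfl⟩, rfl⟩
    obtain ⟨d, hd, h, -⟩ := this
    exact ⟨d, hd, h⟩
  · rw [← hd.balanced (T.map e.toEmbedding) (by rwa [Finset.card_map]),
      ← Set.ncard_image_of_injective _ (Finset.map_injective e.symm.toEmbedding)]
    congr 1
    rw [blocks_map_funLeft]
    ext B
    have hT' : ∀ A : Finset n', T ⊆ A.map e.symm.toEmbedding ↔ T.map e.toEmbedding ⊆ A := by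
      intro A
      simp only [Finset.subset_iff, Finset.mem_map_equiv, Equiv.symm_symm]
      exact ⟨fun h x hx => by simpa using h hx, fun h x hx => h (by simpa using hx)⟩
    constructor
    · rintro ⟨⟨A, hA, rfl⟩, hsub⟩
      exact ⟨A, ⟨hA, (hT' A).mp hsub⟩, rfl⟩
    · rintro ⟨A, ⟨hA, hsub⟩, rfl⟩
      exact ⟨⟨A, hA, rfl⟩, (hT' A).mpr hsub⟩

end Transport

theorem affineCode_map_funLeft {K V W : Type*} [Field K] [AddCommGroup V] [Module K V]
    [AddCommGroup W] [Module K W] (e : V ≃ₗ[K] W) :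
    (affineCode K W).map (LinearMap.funLeft K K e) = affineCode K V := by
  ext f
  constructor
  · rintro ⟨f, ⟨φ, c, hf⟩, rfl⟩
    exact ⟨φ ∘ₗ e, c, fun v => by simp [LinearMap.funLeft_apply, hf]⟩
  · rintro ⟨φ, c, hf⟩
    refine ⟨f ∘ e.symm, ⟨φ ∘ₗ e.symm, c, fun v => by simp [hf]⟩, ?_⟩
    ext v
    simp [LinearMap.funLeft_apply]

theorem reedMuller_one (s : ℕ) : reedMuller 1 s = affineCode (ZMod 2) (Fin s → ZMod 2) := by
  apply le_antisymm
  · rw [reedMuller, MvPolynomial.restrictTotalDegree, MvPolynomial.restrictSupport_eq_span,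
      Submodule.map_span, Submodule.span_le]
    rintro _ ⟨_, ⟨d, hd, rfl⟩, rfl⟩
    have hd' : d.sum (fun _ e => e) ≤ 1 := hd
    change d.degree ≤ 1 at hd'
    rcases Nat.le_one_iff_eq_zero_or_eq_one.mp hd' with h | h
    · rw [Finsupp.degree_eq_zero_iff] at h
      subst h
      exact ⟨0, 1, fun v => by simp [MvPolynomial.evalₗ_apply]⟩
    · obtain ⟨i, rfl⟩ := (Finsupp.range_single_one (σ := Fin s) ▸ h : d ∈ Set.range fun a : Fin s => Finsupp.single a 1)
      exact ⟨LinearMap.proj i, 0, fun v => by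
        simp [MvPolynomial.evalₗ_apply, MvPolynomial.eval_monomial]⟩
  · rintro f ⟨φ, c, hf⟩
    refine ⟨∑ i, MvPolynomial.monomial (Finsupp.single i 1) (φ (Pi.single i 1)) +
      MvPolynomial.C c, ?_, ?_⟩
    · rw [SetLike.mem_coe, MvPolynomial.mem_restrictTotalDegree]
      refine (MvPolynomial.totalDegree_add _ _).trans (max_le ?_ (by simp))
      refine MvPolynomial.totalDegree_finsetSum_le fun i _ => ?_
      refine (MvPolynomial.totalDegree_monomial_le _ _).trans ?_
      simp
    · ext v
      rw [hf, MvPolynomial.evalₗ_apply, LinearMap.pi_apply_eq_sum_univ φ v]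
      simp only [map_add, map_sum, MvPolynomial.eval_C, MvPolynomial.eval_monomial]
      have hs : ∀ i : Fin s, (fun j => if i = j then 1 else 0) = (Pi.single i 1 : Fin s → ZMod 2) := by
        intro i
        ext j
        rw [Pi.single_apply]
        exact if_congr eq_comm rfl rfl
      simp [mul_comm, hs]

/-- The coordinate positions left after deleting the first one are the solutions. -/
def solEquiv {K F : Type*} [Field K] (f g : F → K) : {j : Option (Sol f g) // j ≠ none} ≃ Sol f g where
  toFun j := j.1.get (Option.isSome_iff_ne_none.mpr j.2)
  invFun p := ⟨some p, by simp⟩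
  left_inv j := by simp
  right_inv p := rfl

theorem solEquiv_symm_coe {K F : Type*} [Field K] (f g : F → K) (p : Sol f g) :
    ((solEquiv f g).symm p : Option (Sol f g)) = some p := rfl

/-! ### Subfield codes in terms of functionals -/

section Subfield

variable {K F n ι : Type*} [Field K] [Field F] [Algebra K F]

/-- The functional must vary in the induction: a scalar `a : F` is absorbed by replacing `φ` with `φ
∘ (a * ·)`. -/
theorem dual_comp_mem_subfieldCode [Fintype ι] {k : Type*} (b : Basis ι K F) (G : Matrix k n F)
    {c : n → F} (hc : c ∈ Submodule.span F (Set.range G.row)) (φ : Dual K F) :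
    (fun j => φ (c j)) ∈ subfieldCode b G := by
  induction hc using Submodule.span_induction generalizing φ with
  | mem x hx =>
    obtain ⟨r, rfl⟩ := hx
    have : (fun j => φ (G.row r j)) = ∑ i, φ (b i) • (expandMatrix b G).row (r, i) := by
      ext j
      conv_lhs => rw [← b.sum_repr (G.row r j), map_sum]
      simp [expandMatrix, Matrix.row, mul_comm]
    rw [this]
    exact Submodule.sum_mem _ fun i _ =>
      Submodule.smul_mem _ _ (Submodule.subset_span ⟨(r, i), rfl⟩)
  | zero =>
    simp only [Pi.zero_apply, map_zero]
    exact zero_mem (subfieldCode b G)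
  | add x y _ _ hx hy =>
    simp only [Pi.add_apply, map_add]
    exact add_mem (hx φ) (hy φ)
  | smul a x _ hx => exact hx (φ ∘ₗ LinearMap.mulLeft K a)

/-- This gives independence of the basis and generator matrix: any matrix `M` with the same row
space may be used. -/
theorem subfieldCode_eq_span [Fintype ι] {k l : Type*} (b : Basis ι K F) (G : Matrix k n F)
    (M : Matrix l n F)
    (h : Submodule.span F (Set.range G.row) = Submodule.span F (Set.range M.row)) :
    subfieldCode b G =
      Submodule.span K {w | ∃ (r : l) (φ : Dual K F), w = fun j => φ (M r j)} := by
  apply le_antisymm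
  · have hM : subfieldCode b M ≤
        Submodule.span K {w | ∃ (r : l) (φ : Dual K F), w = fun j => φ (M r j)} := by
      rw [subfieldCode, Submodule.span_le]
      rintro _ ⟨⟨r, i⟩, rfl⟩
      exact Submodule.subset_span ⟨r, b.coord i, rfl⟩
    refine le_trans ?_ hM
    rw [subfieldCode, Submodule.span_le]
    rintro _ ⟨⟨r, i⟩, rfl⟩
    exact dual_comp_mem_subfieldCode b M (h ▸ Submodule.subset_span ⟨r, rfl⟩) (b.coord i)
  · rw [Submodule.span_le]
    rintro _ ⟨r, φ, rfl⟩
    exact dual_comp_mem_subfieldCode b G (c := M.row r)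
      (h ▸ Submodule.subset_span ⟨r, rfl⟩) φ

theorem puncture_subfieldCode [Finite ι] {k : Type*} (b : Basis ι K F) (f g : F → K)
    (G : Matrix k (Option (Sol f g)) F) (hG : Submodule.span F (Set.range G.row) = code f g)
    (S : Submodule K (F × F)) (e : Sol f g ≃ S) (he : ∀ p, (e p : F × F) = p.1) :
    puncture (subfieldCode b G) none =
      (affineCode K S).map (LinearMap.funLeft K K ((solEquiv f g).trans e)) := by
  have := Fintype.ofFinite ι
  rw [puncture, subfieldCode_eq_span b G (genMatrix f g) hG, Submodule.map_span]
  apply le_antisymm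
  · rw [Submodule.span_le]
    rintro _ ⟨_, ⟨r, φ, rfl⟩, rfl⟩
    fin_cases r
    · refine ⟨fun _ => φ 1, ⟨0, φ 1, by simp⟩, ?_⟩
      ext j
      obtain ⟨p, rfl⟩ := (solEquiv f g).symm.surjective j
      simp [LinearMap.funLeft_apply, genMatrix, solEquiv_symm_coe]
    · refine ⟨fun s => φ s.1.1, ⟨φ ∘ₗ LinearMap.fst K F F ∘ₗ S.subtype, 0, by simp⟩, ?_⟩
      ext j
      obtain ⟨p, rfl⟩ := (solEquiv f g).symm.surjective j
      simp [LinearMap.funLeft_apply, genMatrix, solEquiv_symm_coe, he]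
    · refine ⟨fun s => φ s.1.2, ⟨φ ∘ₗ LinearMap.snd K F F ∘ₗ S.subtype, 0, by simp⟩, ?_⟩
      ext j
      obtain ⟨p, rfl⟩ := (solEquiv f g).symm.surjective j
      simp [LinearMap.funLeft_apply, genMatrix, solEquiv_symm_coe, he]
  · rintro _ ⟨w, ⟨φ, c, hw⟩, rfl⟩
    -- Extended to `F × F`, the functional splits into a part in `x` and a part in `y`; `θ` produces
    -- the constant from the row of ones.
    obtain ⟨ψ, hψ⟩ := LinearMap.exists_extend φ
    obtain ⟨θ, hθ⟩ : ∃ θ : Dual K F, θ 1 = c := by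
      obtain ⟨θ, hθ⟩ := Projective.exists_dual_eq_one K (one_ne_zero (α := F))
      exact ⟨c • θ, by simp [hθ]⟩
    have hsplit : LinearMap.funLeft K K ((solEquiv f g).trans e) w =
        LinearMap.funLeft K K Subtype.val (fun j => θ (genMatrix f g 0 j)) +
        LinearMap.funLeft K K Subtype.val
          (fun j => (ψ ∘ₗ LinearMap.inl K F F) (genMatrix f g 1 j)) +
        LinearMap.funLeft K K Subtype.val
          (fun j => (ψ ∘ₗ LinearMap.inr K F F) (genMatrix f g 2 j)) := by
      ext j
      obtain ⟨p, rfl⟩ := (solEquiv f g).symm.surjective j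
      have h1 : φ (e p) = ψ p.1 := by rw [← hψ, ← he]; rfl
      have h2 : ψ p.1 = ψ (p.1.1, 0) + ψ (0, p.1.2) := by rw [← map_add]; simp
      simp [LinearMap.funLeft_apply, genMatrix, solEquiv_symm_coe, hw, hθ, h1, h2]
      ring
    rw [hsplit]
    refine add_mem (add_mem ?_ ?_) ?_
    · exact Submodule.subset_span ⟨_, ⟨0, θ, rfl⟩, rfl⟩
    · exact Submodule.subset_span ⟨_, ⟨1, _, rfl⟩, rfl⟩
    · exact Submodule.subset_span ⟨_, ⟨2, _, rfl⟩, rfl⟩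

end Subfield

/-! ### The solution set as a kernel -/

section Trace

variable {F : Type*} [Field F] [Algebra (ZMod 2) F]

/-- The linear functional `(x, y) ↦ Tr x + Tr (y ^ 2)` over `𝔽₂`. -/
noncomputable def traceSum (F : Type*) [Field F] [Algebra (ZMod 2) F] : F × F →ₗ[ZMod 2] ZMod 2 :=
  AddMonoidHom.toZModLinearMap 2
    { toFun := fun p => traceFun (ZMod 2) F p.1 + traceSqFun (ZMod 2) F p.2
      map_zero' := by simp [traceFun, traceSqFun]
      map_add' := fun p q => by
        have : CharP F 2 := charP_of_injective_algebraMap (algebraMap (ZMod 2) F).injective 2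
        simp only [traceFun, traceSqFun, Prod.fst_add, Prod.snd_add, add_pow_char, map_add]
        ring }

theorem traceSum_apply (p : F × F) :
    traceSum F p = traceFun (ZMod 2) F p.1 + traceSqFun (ZMod 2) F p.2 := rfl

theorem finrank_ker_traceSum [Finite F] :
    finrank (ZMod 2) (LinearMap.ker (traceSum F)) + 1 = 2 * finrank (ZMod 2) F := by
  have hsurj : Function.Surjective (traceSum F) := by
    intro a
    obtain ⟨x, hx⟩ := Algebra.trace_surjective (ZMod 2) F a
    exact ⟨(x, 0), by simp [traceSum_apply, traceFun, traceSqFun, hx]⟩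
  have h := (traceSum F).finrank_range_add_finrank_ker
  rw [LinearMap.range_eq_top.mpr hsurj, finrank_top, finrank_self, finrank_prod] at h
  omega

/-- The solutions of `Tr x + Tr (y ^ 2) = 0` form the kernel of `traceSum`. -/
noncomputable def solEquivKer (F : Type*) [Field F] [Algebra (ZMod 2) F] :
    Sol (traceFun (ZMod 2) F) (traceSqFun (ZMod 2) F) ≃ LinearMap.ker (traceSum F) :=
  Equiv.refl _

end Trace

end CodeDesign

theorem theorem16 (m : ℕ) (hm : 2 ≤ m)
    {F : Type*} [Field F] [Fintype F] [DecidableEq F] [Algebra (ZMod 2) F]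
    (hF : Fintype.card F = 2 ^ m)
    (b : Module.Basis (Fin m) (ZMod 2) F)
    {k : ℕ}
    (G : Matrix (Fin k)
      (Option (CodeDesign.Sol (CodeDesign.traceFun (ZMod 2) F)
        (CodeDesign.traceSqFun (ZMod 2) F))) F)
    (hG : CodeDesign.IsGeneratorMatrix G
      (CodeDesign.code (CodeDesign.traceFun (ZMod 2) F) (CodeDesign.traceSqFun (ZMod 2) F))) :
    CodeDesign.PermEquiv (CodeDesign.puncture (CodeDesign.subfieldCode b G) none)
      (CodeDesign.reedMuller 1 (2 * m - 1)) ∧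
    CodeDesign.HoldsDesign (CodeDesign.puncture (CodeDesign.subfieldCode b G) none)
      3 (2 ^ (2 * m - 1)) (2 ^ (2 * m - 2)) (2 ^ (2 * m - 3) - 1) ∧
    ∀ κ : ℕ, Even κ → 4 ≤ κ → κ ≤ 2 ^ (2 * m - 1) - 4 →
      ∃ lam : ℕ, CodeDesign.HoldsDesign
        (CodeDesign.dualCode (CodeDesign.puncture (CodeDesign.subfieldCode b G) none))
        3 (2 ^ (2 * m - 1)) κ lam := by
  open CodeDesign in
  classical
  have hS : Module.finrank (ZMod 2) (LinearMap.ker (traceSum F)) = 2 * m - 1 := by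
    have h := finrank_ker_traceSum (F := F)
    rw [Module.finrank_eq_card_basis b, Fintype.card_fin] at h
    omega
  let ε : LinearMap.ker (traceSum F) ≃ₗ[ZMod 2] (Fin (2 * m - 1) → ZMod 2) :=
    LinearEquiv.ofFinrankEq _ _ (by rw [hS, Module.finrank_fin_fun])
  have hC := puncture_subfieldCode b _ _ G hG.2 _ (solEquivKer F) fun _ => rfl
  rw [hC]
  refine ⟨⟨((solEquiv _ _).trans (solEquivKer F)).trans ε.toEquiv, ?_⟩, ?_, ?_⟩
  · rw [reedMuller_one, ← affineCode_map_funLeft ε, ← Submodule.map_comp]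
    rfl
  · have := (affineCode_holdsDesign hS (by omega)).map_funLeft
      ((solEquiv _ _).trans (solEquivKer F))
    rwa [show 2 * m - 1 - 1 = 2 * m - 2 by omega, show 2 * m - 1 - 2 = 2 * m - 3 by omega] at this
  · intro κ hκ h4 hle
    -- As `4 ≤ κ`, the subtraction in `hle` is not truncated, so `κ + 4 ≤ 2 ^ (2 * m - 1)`.
    obtain ⟨lam, h⟩ := dualCode_affineCode_holdsDesign hS (by omega) hκ h4 (by omega)
    refine ⟨lam, ?_⟩
    rw [dualCode_map_funLeft]
    exact h.map_funLeft _
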